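/- Let $\sigma>1$. For $h,\tau>0$ and $j\in\mathbb{N}=\{0,1,2,\dots\}$ put $M^{(h,\tau,\sigma)}_j:=h^{j^\sigma}j^{\tau j^\sigma}$ (with $0^0:=1$), and let $\mathcal{M}^\sigma:=\{M^{(\tau,\tau,\sigma)}:\tau>0\}$. The associated function of $M=(M_j)_j$ is $\omega_M(t):=\sup_{j\in\mathbb{N}}\log(t^j/M_j)$ for $t>0$, $\omega_M(0):=0$; write $\omega^{(\sigma)}:=\omega_{M^{(1,1,\sigma)}}$, the associated function of $(j^{j^\sigma})_j$. For a sequence $w=(w_j)_j$ of positive numbers and a compact set $K\subset\mathbb{R}^d$ with $K=\overline{K^\circ}$, let $\mathcal{E}(K)$ be the space of smooth functions on $K^\circ$ all of whose derivatives extend continuously to $K$, and let $\mathcal{E}_w(K)$ be the space of all $f\in\mathcal{E}(K)$ with $\sup_{\alpha\in\mathbb{N}^d,\,x\in K}|f^{(\alpha)}(x)|/w_{|\alpha|}<\infty$, normed by this supremum; put $\mathcal{E}_{M,h}(K):=\mathcal{E}_w(K)$ for $w_j=h^jM_j$, and $\mathcal{E}_{\omega,h}(K):=\mathcal{E}_w(K)$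 for $w_j=\exp(\frac1h\varphi^*_\omega(hj))$, where $\varphi^*_\omega(x)=\sup_{y\ge0}(xy-\omega(e^y))$. For $U\subseteq\mathbb{R}^d$ non-empty and open, define the locally convex spaces (of real- or complex-valued functions) $$\mathcal{E}_{\{\mathcal{M}^\sigma\}}(U)=\varprojlim_{K\subset\subset U}\varinjlim_{\tau>0}\varinjlim_{h>0}\mathcal{E}_{M^{(\tau,\tau,\sigma)},h}(K),\qquad \mathcal{E}_{(\mathcal{M}^\sigma)}(U)=\varprojlim_{K\subset\subset U}\varprojlim_{\tau>0}\varprojlim_{h>0}\mathcal{E}_{M^{(\tau,\tau,\sigma)},h}(K),$$ $$\mathcal{E}_{\{\omega\}}(U)=\varprojlim_{K\subset\subset U}\varinjlim_{h>0}\mathcal{E}_{\omega,h}(K),\qquad \mathcal{E}_{(\omega)}(U)=\varprojlim_{K\subset\subset U}\varprojlim_{h>0}\mathcal{E}_{\omega,h}(K),$$ where the inductive limits are locally convex inductive limits and $K$ runs through the compact subsets of $U$ with $K=\overline{K^\circ}$. A weight function is a continuous non-decreasing $\omega:[0,\infty)\to[0,\infty)$ with $\omega(0)=0$, $\log t=o(\omega(t))$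 and $\omega(2t)=O(\omega(t))$ as $t\to+\infty$, such that $t\mapsto\omega(e^t)$ is convex on $\mathbb{R}$. Two weight functions are equivalent, $\omega\sim\omega'$, if $\omega=O(\omega')$ and $\omega'=O(\omega)$ at $+\infty$. Then: (i) for all $h,\tau>0$ the function $\omega_{M^{(h,\tau,\sigma)}}$ is finite-valued and is a weight function; (ii) for every $d$ and every non-empty open $U\subseteq\mathbb{R}^d$, as locally convex spaces (same functions and same topology), $\mathcal{E}_{\{\mathcal{M}^\sigma\}}(U)=\mathcal{E}_{\{\omega^{(\sigma)}\}}(U)$ and $\mathcal{E}_{(\mathcal{M}^\sigma)}(U)=\mathcal{E}_{(\omega^{(\sigma)})}(U)$; (iii) $\omega_{M^{(h,\tau,\sigma)}}\sim\omega_{M^{(h',\tau',\sigma)}}$ for all $h,h',\tau,\tau'>0$; (iv) in (ii), $\omega^{(\sigma)}$ can be replaced by $\omega_{M^{(h,\tau,\sigma)}}$ for any $h,\tau>0$. -/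

import Mathlib

open Set Filter Topology Asymptotics

noncomputable section

/-! ### Weight sequences, associated functions and weight functions -/

/-- The sequence `M^{(h,τ,σ)}_j = h^{j^σ} j^{τ j^σ}` (for `σ > 0` one has `0 ^ σ = 0` and
`0 ^ 0 = 1`, so that the entry at `j = 0` is `1`). -/
def pttSeq (h τ σ : ℝ) (j : ℕ) : ℝ :=
  h ^ ((j : ℝ) ^ σ) * (j : ℝ) ^ (τ * (j : ℝ) ^ σ)

/-- The weight matrix `M^σ`, whose sequence with index `τ > 0` is `M^{(τ,τ,σ)}`. -/
def pttMatrix (σ : ℝ) (τ : Ioi (0 : ℝ)) : ℕ → ℝ :=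
  pttSeq τ τ σ

/-- The associated function `ω_M(t) = sup_j log (t^j / M_j)` for `t ≠ 0`, `ω_M(0) = 0`. It is used
for `t ≥ 0`, and the supremum is the intended one where the family is bounded above. -/
def assocFun (M : ℕ → ℝ) (t : ℝ) : ℝ :=
  if t = 0 then 0 else ⨆ j : ℕ, Real.log (t ^ j / M j)

/-- Weight functions on `[0, ∞)` in the sense of Braun, Meise and Taylor; the values at negative
arguments play no role. -/
structure IsWeightFunction (ω : ℝ → ℝ) : Prop where
  nonneg : ∀ t, 0 ≤ t → 0 ≤ ω t
  continuousOn : ContinuousOn ω (Ici 0)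
  monotoneOn : MonotoneOn ω (Ici 0)
  map_zero : ω 0 = 0
  log_isLittleO : Real.log =o[atTop] ω
  convexOn_exp : ConvexOn ℝ univ fun t => ω (Real.exp t)
  doubling : (fun t => ω (2 * t)) =O[atTop] ω

/-- Equivalence `ω ∼ ω'` of weight functions: each one is `O` of the other at `+∞`. -/
def WeightEquiv (ω ω' : ℝ → ℝ) : Prop :=
  ω' =O[atTop] ω ∧ ω =O[atTop] ω'

/-- The Young conjugate `φ*_ω(x) = sup_{y ≥ 0} (x y - φ_ω(y))` of `φ_ω(y) = ω(e^y)`. -/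
def youngConj (ω : ℝ → ℝ) (x : ℝ) : ℝ :=
  ⨆ y : Ici (0 : ℝ), (x * (y : ℝ) - ω (Real.exp y))

/-- The weights `h^j M_j`. -/
def geomWeight (M : ℕ → ℝ) (h : ℝ) (j : ℕ) : ℝ :=
  h ^ j * M j

/-- The weights `exp ((1/h) φ*_ω(h j))`. -/
def bmtWeight (ω : ℝ → ℝ) (h : ℝ) (j : ℕ) : ℝ :=
  Real.exp (1 / h * youngConj ω (h * j))

/-! ### Smooth functions and multi-index derivatives -/

/-- Euclidean space `ℝ^d`. -/
abbrev Rn (d : ℕ) : Type := EuclideanSpace ℝ (Fin d)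

variable {𝕜 : Type*} [RCLike 𝕜] {d : ℕ}

/-- Extension by zero of a function on a subset of `ℝ^d`. Only its values on that subset (and, for
open subsets, its derivatives there) are used. -/
def zeroExt (s : Set (Rn d)) : (s → 𝕜) →ₗ[𝕜] (Rn d → 𝕜) :=
  Function.ExtendByZero.linearMap 𝕜 ((↑) : s → Rn d)

/-- The partial derivative `f^{(α)}(x)` for a multi-index `α ∈ ℕ^d`: the derivative of order
`|α|`, evaluated at `α_1` copies of `e_1`, followed by `α_2` copies of `e_2`, and so on. -/
def multiDeriv (α : Fin d → ℕ) (f : Rn d → 𝕜) (x : Rn d) : 𝕜 :=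
  iteratedFDeriv ℝ (∑ i, α i) f x
    fun k => EuclideanSpace.single (finSigmaFinEquiv.symm k).1 (1 : ℝ)

/-- The space `E(U)` of smooth functions on an open set `U ⊆ ℝ^d`. -/
def smoothFun (𝕜 : Type*) [RCLike 𝕜] {d : ℕ} (U : Set (Rn d)) : Submodule 𝕜 (U → 𝕜) where
  carrier := {f | ContDiffOn ℝ ((⊤ : ℕ∞) : WithTop ℕ∞) (zeroExt U f) U}
  add_mem' := by
    intro f g hf hg
    simp only [mem_ofPred_eq, map_add] at *
    exact hf.add hg
  zero_mem' := by
    simp only [mem_ofPred_eq, map_zero]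
    exact contDiffOn_const
  smul_mem' := by
    intro c f hf
    simp only [mem_ofPred_eq, map_smul] at *
    exact hf.const_smul c

theorem smoothFun_contDiffAt {U : Set (Rn d)} (hU : IsOpen U) {f : U → 𝕜}
    (hf : f ∈ smoothFun 𝕜 U) {x : Rn d} (hx : x ∈ U) (n : ℕ) :
    ContDiffAt ℝ n (zeroExt U f) x :=
  (ContDiffOn.contDiffAt hf (hU.mem_nhds hx)).of_le (by exact_mod_cast le_top)

theorem multiDeriv_add {U : Set (Rn d)} (hU : IsOpen U) {f g : U → 𝕜}
    (hf : f ∈ smoothFun 𝕜 U) (hg : g ∈ smoothFun 𝕜 U) (α : Fin d → ℕ) {x : Rn d} (hx : x ∈ U) :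
    multiDeriv α (zeroExt U (f + g)) x
      = multiDeriv α (zeroExt U f) x + multiDeriv α (zeroExt U g) x := by
  simp only [multiDeriv, map_add]
  rw [iteratedFDeriv_add_apply (smoothFun_contDiffAt hU hf hx _)
    (smoothFun_contDiffAt hU hg hx _)]
  rfl

theorem multiDeriv_smul {U : Set (Rn d)} (hU : IsOpen U) (c : 𝕜) {f : U → 𝕜}
    (hf : f ∈ smoothFun 𝕜 U) (α : Fin d → ℕ) {x : Rn d} (hx : x ∈ U) :
    multiDeriv α (zeroExt U (c • f)) x = c * multiDeriv α (zeroExt U f) x := by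
  simp only [multiDeriv, map_smul]
  rw [iteratedFDeriv_const_smul_apply (smoothFun_contDiffAt hU hf hx _)]
  rfl

/-- The space `E(K)` for a compact set `K`: smooth functions on the interior of `K` all of whose
derivatives extend continuously to `K`. -/
def smoothFunCompact (𝕜 : Type*) [RCLike 𝕜] {d : ℕ} (K : Set (Rn d)) :
    Submodule 𝕜 (interior K → 𝕜) where
  carrier := {f | f ∈ smoothFun 𝕜 (interior K) ∧
    ∀ α : Fin d → ℕ, ∃ g : Rn d → 𝕜, ContinuousOn g K ∧
      EqOn g (multiDeriv α (zeroExt (interior K) f)) (interior K)}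
  add_mem' := by
    rintro f g ⟨hf, hf'⟩ ⟨hg, hg'⟩
    refine ⟨add_mem hf hg, fun α => ?_⟩
    obtain ⟨F, hF, hF'⟩ := hf' α
    obtain ⟨G, hG, hG'⟩ := hg' α
    refine ⟨F + G, hF.add hG, fun x hx => ?_⟩
    rw [multiDeriv_add isOpen_interior hf hg α hx, Pi.add_apply, hF' hx, hG' hx]
  zero_mem' := by
    refine ⟨zero_mem _, fun α => ⟨0, continuousOn_const, fun x hx => ?_⟩⟩
    have := multiDeriv_smul isOpen_interior (0 : 𝕜)
      (zero_mem (smoothFun 𝕜 (interior K))) α hx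
    rw [zero_smul, zero_mul] at this
    rw [this, Pi.zero_apply]
  smul_mem' := by
    rintro c f ⟨hf, hf'⟩
    refine ⟨Submodule.smul_mem _ c hf, fun α => ?_⟩
    obtain ⟨F, hF, hF'⟩ := hf' α
    refine ⟨c • F, hF.const_smul c, fun x hx => ?_⟩
    rw [multiDeriv_smul isOpen_interior c hf α hx, Pi.smul_apply, hF' hx, smul_eq_mul]

/-! ### Locally convex spaces of functions -/

/-- A space of `𝕜`-valued functions on `X` together with a topology on it. Equality of two such
objects means that they contain the same functions and carry the same topology. -/
structure FunSpace (𝕜 : Type*) [RCLike 𝕜] (X : Type*) where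
  /-- The functions that belong to the space. -/
  carrier : Submodule 𝕜 (X → 𝕜)
  /-- The topology of the space. -/
  top : TopologicalSpace carrier

/-- The locally convex inductive limit of a (directed) family of spaces of functions on the same
set: the sum of the spaces (for an increasing family: their union) with the finest
locally convex vector space topology for which all inclusions are continuous. -/
def indLim {X : Type*} {ι : Type*} (F : ι → FunSpace 𝕜 X) : FunSpace 𝕜 X where
  carrier := ⨆ i, (F i).carrier
  top := sInf {T : TopologicalSpace ↥(⨆ i, (F i).carrier) |
    @IsTopologicalAddGroup _ T _ ∧ @ContinuousSMul 𝕜 _ _ _ T ∧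
    @LocallyConvexSpace ℝ _ _ _ _ _ T ∧
    ∀ i, @Continuous _ _ (F i).top T
      (Submodule.inclusion (le_iSup (fun i => (F i).carrier) i))}

/-- For a directed family of spaces, the inductive limit consists of the functions that belong to
one of the spaces. -/
theorem mem_indLim_of_directed {X : Type*} {ι : Type*} [Nonempty ι] (F : ι → FunSpace 𝕜 X)
    (hF : Directed (· ≤ ·) fun i => (F i).carrier) (f : X → 𝕜) :
    f ∈ (indLim F).carrier ↔ ∃ i, f ∈ (F i).carrier :=
  Submodule.mem_iSup_of_directed _ hF

/-- The projective limit of a family of spaces of functions on the same set: the intersection of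
the spaces with the coarsest topology for which all inclusions are continuous. -/
def projLim {X : Type*} {ι : Type*} (F : ι → FunSpace 𝕜 X) : FunSpace 𝕜 X where
  carrier := ⨅ i, (F i).carrier
  top := ⨅ i, (F i).top.induced
    (Submodule.inclusion (iInf_le (fun i => (F i).carrier) i))

/-- The regular compact subsets of `U`: those that are the closure of their interior. They are
cofinal among all compact subsets of an open set `U`. -/
abbrev RegCompact (U : Set (Rn d)) : Type :=
  {K : Set (Rn d) // IsCompact K ∧ closure (interior K) = K ∧ K ⊆ U}

/-- Restriction of functions from `U` to the interior of `K ⊆ U`. -/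
def restr {U : Set (Rn d)} (K : RegCompact U) : (U → 𝕜) →ₗ[𝕜] (interior K.1 → 𝕜) :=
  LinearMap.funLeft 𝕜 𝕜 (inclusion (interior_subset.trans K.2.2.2))

theorem restr_mem {U : Set (Rn d)} (F : ∀ K : RegCompact U, FunSpace 𝕜 (interior K.1))
    (K : RegCompact U) (f : ↥(smoothFun 𝕜 U ⊓ ⨅ K, (F K).carrier.comap (restr K))) :
    restr K f.1 ∈ (F K).carrier :=
  (Submodule.mem_iInf _).1 f.2.2 K

/-- The projective limit over all regular compact sets `K ⊂⊂ U`, with respect to restriction: the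
smooth functions on `U` all of whose restrictions belong to the given spaces on `K`, with the
coarsest topology for which all restrictions are continuous. -/
def projLimCompact {U : Set (Rn d)} (F : ∀ K : RegCompact U, FunSpace 𝕜 (interior K.1)) :
    FunSpace 𝕜 U where
  carrier := smoothFun 𝕜 U ⊓ ⨅ K, (F K).carrier.comap (restr K)
  top := ⨅ K, (F K).top.induced fun f => ⟨restr K f.1, restr_mem F K f⟩

/-! ### Ultradifferentiable classes -/

/-- The functions in `E(K)` with `sup_{α, x} |f^{(α)}(x)| / w_{|α|} < ∞`. Since the derivatives
extend continuously to `K`, which is the closure of its interior in all applications, the supremum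
may be taken over the interior of `K`. The weights are positive in all applications. -/
def boundedFun (𝕜 : Type*) [RCLike 𝕜] {d : ℕ} (w : ℕ → ℝ) (K : Set (Rn d)) :
    Submodule 𝕜 (interior K → 𝕜) where
  carrier := {f | f ∈ smoothFunCompact 𝕜 K ∧
    BddAbove (range fun p : (Fin d → ℕ) × interior K =>
      ‖multiDeriv p.1 (zeroExt (interior K) f) p.2‖ / |w (∑ i, p.1 i)|)}
  add_mem' := by
    rintro f g ⟨hf, A, hA⟩ ⟨hg, B, hB⟩
    refine ⟨add_mem hf hg, A + B, ?_⟩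
    rintro _ ⟨p, rfl⟩
    have h1 := hA (mem_range_self p)
    have h2 := hB (mem_range_self p)
    simp only at h1 h2 ⊢
    rw [multiDeriv_add isOpen_interior hf.1 hg.1 p.1 p.2.2]
    calc _ ≤ (‖multiDeriv p.1 (zeroExt (interior K) f) p.2‖
            + ‖multiDeriv p.1 (zeroExt (interior K) g) p.2‖) / |w (∑ i, p.1 i)| := by
          gcongr
          exact norm_add_le _ _
      _ ≤ A + B := by
          rw [add_div]
          exact add_le_add h1 h2
  zero_mem' := by
    refine ⟨zero_mem _, 0, ?_⟩
    rintro _ ⟨p, rfl⟩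
    have := multiDeriv_smul isOpen_interior (0 : 𝕜)
      (zero_mem (smoothFun 𝕜 (interior K))) p.1 p.2.2
    rw [zero_smul, zero_mul] at this
    simp only [this, norm_zero, zero_div, le_refl]
  smul_mem' := by
    rintro c f ⟨hf, A, hA⟩
    refine ⟨Submodule.smul_mem _ c hf, ‖c‖ * A, ?_⟩
    rintro _ ⟨p, rfl⟩
    have h1 := hA (mem_range_self p)
    simp only at h1 ⊢
    rw [multiDeriv_smul isOpen_interior c hf.1 p.1 p.2.2, norm_mul, mul_div_assoc]
    exact mul_le_mul_of_nonneg_left h1 (norm_nonneg c)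

/-- The norm `sup_{α, x} |f^{(α)}(x)| / w_{|α|}`. -/
def supNorm (𝕜 : Type*) [RCLike 𝕜] {d : ℕ} (w : ℕ → ℝ) (K : Set (Rn d)) :
    Seminorm 𝕜 (boundedFun 𝕜 w K) :=
  Seminorm.of
    (fun f => ⨆ p : (Fin d → ℕ) × interior K,
      ‖multiDeriv p.1 (zeroExt (interior K) f.1) p.2‖ / |w (∑ i, p.1 i)|)
    (by
      intro f g
      refine Real.iSup_le (fun p => ?_) (add_nonneg
        (Real.iSup_nonneg fun p => by positivity) (Real.iSup_nonneg fun p => by positivity))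
      refine le_trans ?_ (add_le_add (le_ciSup f.2.2 p) (le_ciSup g.2.2 p))
      rw [Submodule.coe_add, multiDeriv_add isOpen_interior f.2.1.1 g.2.1.1 p.1 p.2.2, ← add_div]
      gcongr
      exact norm_add_le _ _)
    (by
      intro c f
      rw [Real.mul_iSup_of_nonneg (norm_nonneg c)]
      congr 1
      funext p
      rw [Submodule.coe_smul, multiDeriv_smul isOpen_interior c f.2.1.1 p.1 p.2.2, norm_mul,
        mul_div_assoc])

/-- The normed space of all `f ∈ E(K)` with `sup_{α, x} |f^{(α)}(x)| / w_{|α|} < ∞`. -/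
def stepSpace (𝕜 : Type*) [RCLike 𝕜] {d : ℕ} (w : ℕ → ℝ) (K : Set (Rn d)) :
    FunSpace 𝕜 (interior K) where
  carrier := boundedFun 𝕜 w K
  top := (supNorm 𝕜 w K).toAddGroupSeminorm.toSeminormedAddCommGroup.toPseudoMetricSpace
    |>.toUniformSpace.toTopologicalSpace

/-- The Roumieu class `E_{{𝓜}}(U)` of a weight matrix `𝓜 = {M^{(x)} : x > 0}`. -/
def matrixRoumieu (𝕜 : Type*) [RCLike 𝕜] {d : ℕ} (M : Ioi (0 : ℝ) → ℕ → ℝ) (U : Set (Rn d)) :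
    FunSpace 𝕜 U :=
  projLimCompact fun K => indLim fun x : Ioi (0 : ℝ) => indLim fun h : Ioi (0 : ℝ) =>
    stepSpace 𝕜 (geomWeight (M x) h) K.1

/-- The Beurling class `E_{(𝓜)}(U)` of a weight matrix `𝓜 = {M^{(x)} : x > 0}`. -/
def matrixBeurling (𝕜 : Type*) [RCLike 𝕜] {d : ℕ} (M : Ioi (0 : ℝ) → ℕ → ℝ) (U : Set (Rn d)) :
    FunSpace 𝕜 U :=
  projLimCompact fun K => projLim fun x : Ioi (0 : ℝ) => projLim fun h : Ioi (0 : ℝ) =>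
    stepSpace 𝕜 (geomWeight (M x) h) K.1

/-- The Braun–Meise–Taylor class `E_{{ω}}(U)` of Roumieu type. -/
def bmtRoumieu (𝕜 : Type*) [RCLike 𝕜] {d : ℕ} (ω : ℝ → ℝ) (U : Set (Rn d)) : FunSpace 𝕜 U :=
  projLimCompact fun K => indLim fun h : Ioi (0 : ℝ) => stepSpace 𝕜 (bmtWeight ω h) K.1

/-- The Braun–Meise–Taylor class `E_{(ω)}(U)` of Beurling type. -/
def bmtBeurling (𝕜 : Type*) [RCLike 𝕜] {d : ℕ} (ω : ℝ → ℝ) (U : Set (Rn d)) : FunSpace 𝕜 U :=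
  projLimCompact fun K => projLim fun h : Ioi (0 : ℝ) => stepSpace 𝕜 (bmtWeight ω h) K.1

end

section

variable {𝕜 : Type*} [RCLike 𝕜] {d : ℕ}

/-! ### Growth of the sequences -/

/-! Everything is measured against `powLog σ j`, that is, j^σ log j. The logarithm of M_j^{(h,τ,σ)}
is comparable to τ j^σ log j, whatever h is, and since σ > 1 a geometric factor l^j is negligible
beside it. The Young conjugate of the associated function grows like x^σ log x. Hence the weight
exp((1/l) φ*(l j)) has logarithm comparable to l^(σ-1) j^σ log j, with constants independent of l
(`exists_bmtWeight_bounds`). As l^(σ-1) takes every positive value, varying τ in the matrix and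
varying l for the weight function give mutually cofinal families of weights
(`geomWeight_bmtWeight_cofinal`). Cofinal families have the same limits, topology included, by the
universal properties of the limits. Doubling and equivalence have a common source,
`exists_pttSeq_comparison`: since L (k/L)^σ = L^(1-σ) k^σ, the k-th term of one supremum is
controlled, for large L, by L times the term of index ⌈k/L⌉ of the other. -/

/-- The comparison function `x ^ σ * log x`. -/
noncomputable def powLog (σ x : ℝ) : ℝ := x ^ σ * Real.log x

theorem powLog_nonneg {σ x : ℝ} (hx : 1 ≤ x) : 0 ≤ powLog σ x :=
  mul_nonneg (Real.rpow_nonneg (by linarith) _) (Real.log_nonneg hx)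

theorem powLog_le_powLog {σ x y : ℝ} (hσ : 0 ≤ σ) (hx : 1 ≤ x) (hxy : x ≤ y) :
    powLog σ x ≤ powLog σ y := by
  have h0 : 0 < x := by linarith
  exact mul_le_mul (Real.rpow_le_rpow h0.le hxy hσ) (Real.log_le_log h0 hxy)
    (Real.log_nonneg hx) (Real.rpow_nonneg (by linarith) _)

theorem eventually_mul_le_powLog {σ : ℝ} (hσ : 1 ≤ σ) (c : ℝ) {ε : ℝ} (hε : 0 < ε) :
    ∀ᶠ x : ℝ in atTop, c * x ≤ ε * powLog σ x := by
  filter_upwards [eventually_ge_atTop 1, Real.tendsto_log_atTop.eventually_ge_atTop (|c| / ε)]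
    with x hx hlog
  have h0 : 0 < x := by linarith
  have h1 : x ≤ x ^ σ := Real.self_le_rpow_of_one_le hx hσ
  have h2 : |c| ≤ ε * Real.log x := by rwa [div_le_iff₀' hε] at hlog
  calc c * x ≤ |c| * x := by gcongr; exact le_abs_self c
    _ ≤ (ε * Real.log x) * x := by gcongr
    _ ≤ (ε * Real.log x) * x ^ σ := by
        gcongr
        exact (abs_nonneg c).trans h2
    _ = _ := by unfold powLog; ring

theorem eventually_const_le_powLog {σ : ℝ} (hσ : 1 ≤ σ) (c : ℝ) {ε : ℝ} (hε : 0 < ε) :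
    ∀ᶠ x : ℝ in atTop, c ≤ ε * powLog σ x := by
  filter_upwards [eventually_ge_atTop 1, eventually_mul_le_powLog hσ |c| hε] with x hx h
  nlinarith [abs_nonneg c, le_abs_self c]

/-- For large x, log (c x) = log c + log x lies between half of and twice log x. -/
theorem eventually_powLog_mul_bounds (σ : ℝ) {c : ℝ} (hc : 0 < c) :
    ∀ᶠ x : ℝ in atTop, c ^ σ / 2 * powLog σ x ≤ powLog σ (c * x) ∧
      powLog σ (c * x) ≤ 2 * c ^ σ * powLog σ x := by
  filter_upwards [eventually_ge_atTop 1,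
    Real.tendsto_log_atTop.eventually_ge_atTop (2 * |Real.log c|)] with x hx hlog
  have h0 : 0 < x := by linarith
  have h1 : 0 < c ^ σ * x ^ σ := by positivity
  have h2 := le_abs_self (Real.log c)
  have h3 := neg_abs_le (Real.log c)
  unfold powLog
  rw [Real.mul_rpow hc.le h0.le, Real.log_mul hc.ne' h0.ne']
  constructor
  · calc _ = c ^ σ * x ^ σ * (Real.log x / 2) := by ring
      _ ≤ _ := by gcongr; linarith
  · calc _ ≤ c ^ σ * x ^ σ * (2 * Real.log x) := by gcongr; linarith
      _ = _ := by ring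

theorem exists_forall_le_of_eventually_le {f : ℕ → ℝ} {B : ℝ} (h : ∀ᶠ n in atTop, f n ≤ B) :
    ∃ A, 0 ≤ A ∧ ∀ n, f n ≤ A := by
  obtain ⟨N, hN⟩ := eventually_atTop.1 h
  refine ⟨|B| + ∑ i ∈ Finset.range N, |f i|, by positivity, fun n => ?_⟩
  have h0 : 0 ≤ ∑ i ∈ Finset.range N, |f i| := Finset.sum_nonneg fun i _ => abs_nonneg _
  rcases lt_or_ge n N with hn | hn
  · have := Finset.single_le_sum (f := fun i => |f i|) (fun i _ => abs_nonneg _)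
      (Finset.mem_range.2 hn)
    have h1 := le_abs_self (f n)
    have h2 := abs_nonneg B
    linarith
  · linarith [hN n hn, le_abs_self B]

/-! ### Two-sided bounds for the logarithms of the sequences -/

theorem pttSeq_pos {h τ σ : ℝ} (hh : 0 < h) (hσ : 0 < σ) (j : ℕ) : 0 < pttSeq h τ σ j := by
  unfold pttSeq
  rcases Nat.eq_zero_or_pos j with rfl | hj
  · simp [Real.zero_rpow hσ.ne']
  · positivity

theorem log_pttSeq {h τ σ : ℝ} (hh : 0 < h) (hσ : 0 < σ) (j : ℕ) :
    Real.log (pttSeq h τ σ j) = (j : ℝ) ^ σ * (Real.log h + τ * Real.log j) := by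
  unfold pttSeq
  rcases Nat.eq_zero_or_pos j with rfl | hj
  · simp [Real.zero_rpow hσ.ne']
  · have : (0 : ℝ) < j := by exact_mod_cast hj
    rw [Real.log_mul (by positivity) (by positivity), Real.log_rpow hh, Real.log_rpow this]
    ring

theorem pttSeq_zero {h τ σ : ℝ} (hσ : 0 < σ) : pttSeq h τ σ 0 = 1 := by
  simp [pttSeq, Real.zero_rpow hσ.ne']

theorem eventually_log_pttSeq_bounds {h τ σ : ℝ} (hh : 0 < h) (hτ : 0 < τ) (hσ : 0 < σ) :
    ∀ᶠ j : ℕ in atTop, τ / 2 * powLog σ j ≤ Real.log (pttSeq h τ σ j) ∧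
      Real.log (pttSeq h τ σ j) ≤ 2 * τ * powLog σ j := by
  filter_upwards [(Real.tendsto_log_atTop.comp tendsto_natCast_atTop_atTop).eventually_ge_atTop
    (2 * |Real.log h| / τ)] with j hlog
  have h1 : 2 * |Real.log h| ≤ τ * Real.log j := by
    rwa [div_le_iff₀' hτ] at hlog
  have h2 := le_abs_self (Real.log h)
  have h3 := neg_abs_le (Real.log h)
  have h4 : 0 ≤ (j : ℝ) ^ σ := by positivity
  rw [log_pttSeq hh hσ]
  unfold powLog
  constructor
  · calc _ = (j : ℝ) ^ σ * (τ * Real.log j / 2) := by ring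
      _ ≤ _ := by gcongr; linarith
  · calc _ ≤ (j : ℝ) ^ σ * (2 * (τ * Real.log j)) := by gcongr; linarith
      _ = _ := by ring

theorem eventually_mul_le_log_pttSeq {h τ σ : ℝ} (hh : 0 < h) (hτ : 0 < τ) (hσ : 1 < σ) (c : ℝ) :
    ∀ᶠ j : ℕ in atTop, c * j ≤ Real.log (pttSeq h τ σ j) := by
  filter_upwards [eventually_log_pttSeq_bounds (σ := σ) hh hτ (by linarith),
    tendsto_natCast_atTop_atTop.eventually (eventually_mul_le_powLog hσ.le c (half_pos hτ))]
    with j h1 h2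
  exact h2.trans h1.1

/-- With c = log t this makes the associated function finite at t; with c = 0 it bounds log M_j from
below, which is needed because M_j may drop below 1 when h < 1. -/
theorem exists_mul_le_log_pttSeq_add {h τ σ : ℝ} (hh : 0 < h) (hτ : 0 < τ) (hσ : 1 < σ) (c : ℝ) :
    ∃ A, 0 ≤ A ∧ ∀ j : ℕ, c * j ≤ Real.log (pttSeq h τ σ j) + A := by
  obtain ⟨A, hA, H⟩ := exists_forall_le_of_eventually_le
    (f := fun j : ℕ => c * j - Real.log (pttSeq h τ σ j)) (B := 0)
    ((eventually_mul_le_log_pttSeq hh hτ hσ c).mono fun j hj => by linarith)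
  exact ⟨A, hA, fun j => by linarith [H j]⟩

/-- The left side equals c 2^σ L^(1-σ), which tends to 0 because σ > 1. The 2 pays for rounding k/L
up to an integer. -/
theorem exists_rpow_mul_le {σ c ε : ℝ} (hσ : 1 < σ) (hε : 0 < ε) :
    ∃ L : ℕ, 1 ≤ L ∧ L * (c * (2 / (L : ℝ)) ^ σ) ≤ ε := by
  have h1 : Tendsto (fun L : ℕ => c * 2 ^ σ * (L : ℝ) ^ (-(σ - 1))) atTop (𝓝 (c * 2 ^ σ * 0)) :=
    ((tendsto_rpow_neg_atTop (by linarith)).comp tendsto_natCast_atTop_atTop).const_mul _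
  rw [mul_zero] at h1
  obtain ⟨L, hL, hL1⟩ := ((h1.eventually (gt_mem_nhds hε)).and (eventually_ge_atTop 1)).exists
  refine ⟨L, hL1, le_trans (le_of_eq ?_) hL.le⟩
  have h0 : (0 : ℝ) < L := by exact_mod_cast hL1
  rw [Real.div_rpow (by norm_num) h0.le, neg_sub, Real.rpow_sub h0, Real.rpow_one]
  ring

theorem eventually_natCeil_div_le {c : ℝ} (hc : 0 < c) :
    ∀ᶠ k : ℕ in atTop, ((⌈c * k⌉₊ : ℕ) : ℝ) ≤ 2 * c * k := by
  filter_upwards [tendsto_natCast_atTop_atTop.eventually_ge_atTop (1 / c)] with k hk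
  rw [div_le_iff₀' hc] at hk
  linarith [Nat.ceil_lt_add_one (a := c * (k : ℝ)) (by positivity)]

theorem tendsto_natCeil_mul {c : ℝ} (hc : 0 < c) :
    Tendsto (fun k : ℕ => ⌈c * (k : ℝ)⌉₊) atTop atTop :=
  tendsto_nat_ceil_atTop.comp (tendsto_natCast_atTop_atTop.const_mul_atTop hc)

/-- Along `k ↦ ⌈c k⌉` the sequence grows at most like `(2c)^σ k^σ log k`. -/
theorem eventually_log_pttSeq_natCeil_le {h τ σ c : ℝ} (hh : 0 < h) (hτ : 0 < τ) (hσ : 0 < σ)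
    (hc : 0 < c) :
    ∀ᶠ k : ℕ in atTop,
      Real.log (pttSeq h τ σ ⌈c * k⌉₊) ≤ 4 * τ * (2 * c) ^ σ * powLog σ k := by
  filter_upwards [eventually_natCeil_div_le hc,
    (tendsto_natCeil_mul hc).eventually (eventually_log_pttSeq_bounds (σ := σ) hh hτ hσ),
    (tendsto_natCeil_mul hc).eventually (eventually_ge_atTop 1),
    tendsto_natCast_atTop_atTop.eventually (eventually_powLog_mul_bounds σ (c := 2 * c)
      (by positivity))] with k h1 h2 h3 h4
  calc _ ≤ 2 * τ * powLog σ (⌈c * k⌉₊ : ℕ) := h2.2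
    _ ≤ 2 * τ * powLog σ (2 * c * k) := by
        gcongr
        exact powLog_le_powLog hσ.le (by exact_mod_cast h3) h1
    _ ≤ 2 * τ * (2 * (2 * c) ^ σ * powLog σ k) := by gcongr; exact h4.2
    _ = _ := by ring

/-- The witness is j = ⌈k/L⌉. The summand k ρ leaves room for a dilation of the argument by e^ρ. -/
theorem exists_pttSeq_comparison {h τ h' τ' σ : ℝ} (hh : 0 < h) (hτ : 0 < τ) (hh' : 0 < h')
    (hτ' : 0 < τ') (hσ : 1 < σ) (ρ : ℝ) :
    ∃ L : ℕ, ∃ A : ℝ, ∀ k : ℕ, ∃ j : ℕ, k ≤ L * j ∧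
      k * ρ + L * Real.log (pttSeq h τ σ j) ≤ Real.log (pttSeq h' τ' σ k) + A := by
  -- The lower bound τ'/2 for the second sequence is split evenly: τ'/4 for the first sequence at
  -- ⌈k/L⌉, τ'/4 for k ρ.
  obtain ⟨L, hL1, hL⟩ := exists_rpow_mul_le (σ := σ) (c := 4 * τ) (ε := τ' / 4) hσ (by positivity)
  have h0 : (0 : ℝ) < L := by exact_mod_cast hL1
  have hev : ∀ᶠ k : ℕ in atTop, k * ρ + L * Real.log (pttSeq h τ σ ⌈(1 / (L : ℝ)) * k⌉₊)
      - Real.log (pttSeq h' τ' σ k) ≤ 0 := by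
    filter_upwards [eventually_log_pttSeq_natCeil_le (σ := σ) (c := 1 / (L : ℝ)) hh hτ
        (by linarith) (by positivity),
      eventually_log_pttSeq_bounds (σ := σ) hh' hτ' (by linarith), eventually_ge_atTop 1,
      tendsto_natCast_atTop_atTop.eventually
        (eventually_mul_le_powLog hσ.le ρ (ε := τ' / 4) (by positivity))] with k h1 h2 h3 h4
    have h5 : 0 ≤ powLog σ k := powLog_nonneg (by exact_mod_cast h3)
    have h6 := mul_le_mul_of_nonneg_left h1 h0.le
    have h7 := mul_le_mul_of_nonneg_right hL h5
    have h8 : (2 * (1 / (L : ℝ))) = 2 / L := by ring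
    rw [h8] at h6
    linarith [h2.1]
  obtain ⟨A, -, hA⟩ := exists_forall_le_of_eventually_le hev
  refine ⟨L, A, fun k => ⟨⌈(1 / (L : ℝ)) * k⌉₊, ?_, by linarith [hA k]⟩⟩
  have h1 := mul_le_mul_of_nonneg_left (Nat.le_ceil ((1 / (L : ℝ)) * k)) h0.le
  rw [← mul_assoc, mul_one_div_cancel h0.ne', one_mul] at h1
  exact_mod_cast h1

/-! ### Associated functions -/

theorem log_pow_div_pttSeq {h τ σ t : ℝ} (hh : 0 < h) (hσ : 0 < σ) (ht : 0 < t) (j : ℕ) :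
    Real.log (t ^ j / pttSeq h τ σ j) = j * Real.log t - Real.log (pttSeq h τ σ j) := by
  rw [Real.log_div (by positivity) (pttSeq_pos hh hσ j).ne', Real.log_pow]

theorem bddAbove_log_pow_div_pttSeq {h τ σ t : ℝ} (hh : 0 < h) (hτ : 0 < τ) (hσ : 1 < σ)
    (ht : 0 < t) : BddAbove (range fun j : ℕ => Real.log (t ^ j / pttSeq h τ σ j)) := by
  obtain ⟨A, -, hA⟩ := exists_mul_le_log_pttSeq_add hh hτ hσ (Real.log t)
  refine ⟨A, ?_⟩
  rintro _ ⟨j, rfl⟩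
  simp only [log_pow_div_pttSeq hh (by linarith : 0 < σ) ht]
  linarith [hA j]

theorem le_assocFun_pttSeq {h τ σ t : ℝ} (hh : 0 < h) (hτ : 0 < τ) (hσ : 1 < σ) (ht : 0 < t)
    (j : ℕ) : j * Real.log t - Real.log (pttSeq h τ σ j) ≤ assocFun (pttSeq h τ σ) t := by
  rw [assocFun, if_neg ht.ne', ← log_pow_div_pttSeq hh (by linarith : 0 < σ) ht]
  exact le_ciSup (bddAbove_log_pow_div_pttSeq hh hτ hσ ht) j

theorem assocFun_pttSeq_le {h τ σ t B : ℝ} (hh : 0 < h) (hσ : 0 < σ) (ht : 0 < t)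
    (H : ∀ j : ℕ, j * Real.log t - Real.log (pttSeq h τ σ j) ≤ B) :
    assocFun (pttSeq h τ σ) t ≤ B := by
  rw [assocFun, if_neg ht.ne']
  exact ciSup_le fun j => by rw [log_pow_div_pttSeq hh hσ ht]; exact H j

theorem assocFun_pttSeq_nonneg {h τ σ t : ℝ} (hh : 0 < h) (hτ : 0 < τ) (hσ : 1 < σ)
    (ht : 0 ≤ t) : 0 ≤ assocFun (pttSeq h τ σ) t := by
  rcases ht.eq_or_lt with rfl | ht
  · simp [assocFun]
  · simpa [pttSeq_zero (by linarith : 0 < σ)] using le_assocFun_pttSeq hh hτ hσ ht 0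

theorem monotoneOn_assocFun_pttSeq {h τ σ : ℝ} (hh : 0 < h) (hτ : 0 < τ) (hσ : 1 < σ) :
    MonotoneOn (assocFun (pttSeq h τ σ)) (Ici 0) := by
  intro s hs t ht hst
  rcases (mem_Ici.1 hs).eq_or_lt with rfl | hs
  · simpa [assocFun] using assocFun_pttSeq_nonneg hh hτ hσ ht
  · refine assocFun_pttSeq_le hh (by linarith) hs fun j => le_trans ?_
      (le_assocFun_pttSeq hh hτ hσ (hs.trans_le hst) j)
    gcongr

/-- In the variable y = log t the function is a supremum of affine functions. -/
theorem convexOn_assocFun_pttSeq_exp {h τ σ : ℝ} (hh : 0 < h) (hτ : 0 < τ) (hσ : 1 < σ) :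
    ConvexOn ℝ univ fun y => assocFun (pttSeq h τ σ) (Real.exp y) := by
  refine ⟨convex_univ, fun x _ y _ a b ha hb hab => ?_⟩
  refine assocFun_pttSeq_le hh (by linarith) (Real.exp_pos _) fun j => ?_
  have h1 := le_assocFun_pttSeq hh hτ hσ (Real.exp_pos x) j
  have h2 := le_assocFun_pttSeq hh hτ hσ (Real.exp_pos y) j
  rw [Real.log_exp] at *
  have h3 := add_le_add (mul_le_mul_of_nonneg_left h1 ha) (mul_le_mul_of_nonneg_left h2 hb)
  simp only [smul_eq_mul]
  refine le_trans (le_of_eq ?_) h3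
  linear_combination Real.log (pttSeq h τ σ j) * hab

/-- If log t ≤ -A, where log M_j ≥ -A for all j, every term with j ≥ 1 is at most 0, and the term j
= 0 is 0 because M_0 = 1. -/
theorem eventually_assocFun_pttSeq_eq_zero {h τ σ : ℝ} (hh : 0 < h) (hτ : 0 < τ) (hσ : 1 < σ) :
    ∃ δ > 0, ∀ t, 0 ≤ t → t < δ → assocFun (pttSeq h τ σ) t = 0 := by
  obtain ⟨A, hA0, hA⟩ := exists_mul_le_log_pttSeq_add hh hτ hσ 0
  refine ⟨Real.exp (-A), Real.exp_pos _, fun t ht0 ht => ?_⟩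
  rcases ht0.eq_or_lt with rfl | ht0
  · simp [assocFun]
  refine le_antisymm (assocFun_pttSeq_le hh (by linarith) ht0 fun j => ?_)
    (assocFun_pttSeq_nonneg hh hτ hσ ht0.le)
  rcases Nat.eq_zero_or_pos j with rfl | hj
  · simp [pttSeq_zero (by linarith : 0 < σ)]
  · have h1 : Real.log t ≤ -A := by
      rw [← Real.log_exp (-A)]
      exact Real.log_le_log ht0 ht.le
    have h2 : (1 : ℝ) ≤ j := by exact_mod_cast hj
    have := hA j
    nlinarith

/-- At 0 the function is locally constant; at t > 0 continuity comes from convexity in log t. -/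
theorem continuousOn_assocFun_pttSeq {h τ σ : ℝ} (hh : 0 < h) (hτ : 0 < τ) (hσ : 1 < σ) :
    ContinuousOn (assocFun (pttSeq h τ σ)) (Ici 0) := by
  intro t ht
  rcases (mem_Ici.1 ht).eq_or_lt with rfl | ht
  · obtain ⟨δ, hδ, H⟩ := eventually_assocFun_pttSeq_eq_zero hh hτ hσ
    refine (continuousWithinAt_const (b := (0 : ℝ))).congr_of_eventuallyEq ?_ (H 0 le_rfl hδ)
    filter_upwards [self_mem_nhdsWithin, mem_nhdsWithin_of_mem_nhds (gt_mem_nhds hδ)] with s h1 h2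
    exact H s h1 h2
  · have h1 : Continuous fun y => assocFun (pttSeq h τ σ) (Real.exp y) :=
      continuousOn_univ.1 ((convexOn_assocFun_pttSeq_exp hh hτ hσ).continuousOn isOpen_univ)
    have h2 : ContinuousAt (fun s => assocFun (pttSeq h τ σ) (Real.exp (Real.log s))) t :=
      h1.continuousAt.comp (Real.continuousAt_log ht.ne')
    refine (h2.congr ?_).continuousWithinAt
    filter_upwards [lt_mem_nhds ht] with s hs
    rw [Real.exp_log hs]

theorem log_isLittleO_assocFun_pttSeq {h τ σ : ℝ} (hh : 0 < h) (hτ : 0 < τ) (hσ : 1 < σ) :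
    Real.log =o[atTop] assocFun (pttSeq h τ σ) := by
  refine isLittleO_iff.2 fun c hc => ?_
  -- The single term of index n suffices: (1/c) log t is the gain, and one further log t absorbs log
  -- M_n.
  obtain ⟨n, hn⟩ := exists_nat_ge (1 / c + 1)
  filter_upwards [eventually_ge_atTop 1,
    Real.tendsto_log_atTop.eventually_ge_atTop (Real.log (pttSeq h τ σ n))] with t ht hlog
  have h0 : 0 < t := by linarith
  have h1 := le_assocFun_pttSeq hh hτ hσ h0 n
  have h2 := Real.log_nonneg ht
  rw [Real.norm_of_nonneg h2, Real.norm_of_nonneg (assocFun_pttSeq_nonneg hh hτ hσ h0.le),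
    ← div_le_iff₀' hc]
  have h3 := mul_le_mul_of_nonneg_right hn h2
  have h4 : Real.log t / c = 1 / c * Real.log t := by ring
  linarith

/-- The change of the parameters and a dilation of the argument cost only a constant factor. -/
theorem assocFun_pttSeq_dilation_isBigO {h τ h' τ' σ : ℝ} (hh : 0 < h) (hτ : 0 < τ) (hh' : 0 < h')
    (hτ' : 0 < τ') (hσ : 1 < σ) {r : ℝ} (hr : 0 < r) :
    (fun t => assocFun (pttSeq h' τ' σ) (r * t)) =O[atTop] assocFun (pttSeq h τ σ) := by
  obtain ⟨L, A, H⟩ := exists_pttSeq_comparison hh hτ hh' hτ' hσ (Real.log r)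
  -- L comes from k ≤ L j; the extra 1 absorbs the additive constant, as A ≤ log t ≤ ω(t) for large
  -- t.
  refine IsBigO.of_bound (L + 1) ?_
  filter_upwards [eventually_ge_atTop 1,
    (log_isLittleO_assocFun_pttSeq hh hτ hσ).bound one_pos,
    Real.tendsto_log_atTop.eventually_ge_atTop A] with t ht h1 h2
  have h0 : 0 < t := by linarith
  have h3 := Real.log_nonneg ht
  rw [one_mul, Real.norm_of_nonneg h3,
    Real.norm_of_nonneg (assocFun_pttSeq_nonneg hh hτ hσ h0.le)] at h1
  rw [Real.norm_of_nonneg (assocFun_pttSeq_nonneg hh' hτ' hσ (by positivity)),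
    Real.norm_of_nonneg (assocFun_pttSeq_nonneg hh hτ hσ h0.le)]
  refine assocFun_pttSeq_le hh' (by linarith) (by positivity) fun k => ?_
  obtain ⟨j, hkj, hj⟩ := H k
  have h4 := mul_le_mul_of_nonneg_left (le_assocFun_pttSeq hh hτ hσ h0 j) (Nat.cast_nonneg L)
  have h5 : (k : ℝ) * Real.log t ≤ L * j * Real.log t := by
    gcongr
    exact_mod_cast hkj
  rw [Real.log_mul hr.ne' h0.ne']
  linarith

theorem isWeightFunction_assocFun_pttSeq {h τ σ : ℝ} (hh : 0 < h) (hτ : 0 < τ) (hσ : 1 < σ) :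
    IsWeightFunction (assocFun (pttSeq h τ σ)) where
  nonneg _ ht := assocFun_pttSeq_nonneg hh hτ hσ ht
  continuousOn := continuousOn_assocFun_pttSeq hh hτ hσ
  monotoneOn := monotoneOn_assocFun_pttSeq hh hτ hσ
  map_zero := by simp [assocFun]
  log_isLittleO := log_isLittleO_assocFun_pttSeq hh hτ hσ
  convexOn_exp := convexOn_assocFun_pttSeq_exp hh hτ hσ
  doubling := assocFun_pttSeq_dilation_isBigO hh hτ hh hτ hσ two_pos

theorem weightEquiv_assocFun_pttSeq {h τ h' τ' σ : ℝ} (hh : 0 < h) (hτ : 0 < τ) (hh' : 0 < h')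
    (hτ' : 0 < τ') (hσ : 1 < σ) :
    WeightEquiv (assocFun (pttSeq h τ σ)) (assocFun (pttSeq h' τ' σ)) := by
  constructor
  · simpa using assocFun_pttSeq_dilation_isBigO hh hτ hh' hτ' hσ one_pos
  · simpa using assocFun_pttSeq_dilation_isBigO hh' hτ' hh hτ hσ one_pos

/-! ### The weights of the two kinds of classes -/

/-- Only the term of index ⌈x⌉ of the supremum defining ω(e^y) is kept. -/
theorem mul_sub_assocFun_exp_le {h τ σ x y : ℝ} (hh : 0 < h) (hτ : 0 < τ) (hσ : 1 < σ)
    (hy : 0 ≤ y) : x * y - assocFun (pttSeq h τ σ) (Real.exp y)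
      ≤ Real.log (pttSeq h τ σ ⌈x⌉₊) := by
  have h1 := le_assocFun_pttSeq hh hτ hσ (Real.exp_pos y) ⌈x⌉₊
  rw [Real.log_exp] at h1
  have h2 := mul_le_mul_of_nonneg_right (Nat.le_ceil x) hy
  linarith

theorem youngConj_assocFun_le {h τ σ : ℝ} (hh : 0 < h) (hτ : 0 < τ) (hσ : 1 < σ) (x : ℝ) :
    youngConj (assocFun (pttSeq h τ σ)) x ≤ Real.log (pttSeq h τ σ ⌈x⌉₊) :=
  ciSup_le fun y => mul_sub_assocFun_exp_le hh hτ hσ y.2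

theorem le_youngConj_assocFun {h τ σ x y : ℝ} (hh : 0 < h) (hτ : 0 < τ) (hσ : 1 < σ)
    (hy : 0 ≤ y) : x * y - assocFun (pttSeq h τ σ) (Real.exp y)
      ≤ youngConj (assocFun (pttSeq h τ σ)) x :=
  le_ciSup (f := fun y : Ici (0 : ℝ) => x * (y : ℝ) - assocFun (pttSeq h τ σ) (Real.exp y))
    ⟨_, by rintro _ ⟨y, rfl⟩; exact mul_sub_assocFun_exp_le hh hτ hσ y.2⟩ ⟨y, hy⟩

/-- The conjugate is tested at one point y with ω(e^y) ≤ k y + A; since x ≥ 2k, this leaves x y -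
ω(e^y) ≥ k y - A. -/
theorem exists_powLog_le_youngConj {h τ σ : ℝ} (hh : 0 < h) (hτ : 0 < τ) (hσ : 1 < σ) :
    ∃ A, ∀ᶠ k : ℕ in atTop, ∀ x : ℝ, 2 * k ≤ x →
      τ / 2 * powLog σ k - A ≤ youngConj (assocFun (pttSeq h τ σ)) x := by
  obtain ⟨A, hA0, hA⟩ := exists_mul_le_log_pttSeq_add hh hτ hσ 0
  obtain ⟨N, hN⟩ := eventually_atTop.1
    (eventually_log_pttSeq_bounds (σ := σ) hh hτ (by linarith))
  refine ⟨A, ?_⟩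
  filter_upwards [eventually_ge_atTop N, eventually_ge_atTop 1] with k hkN hk1 x hx
  have hk : (1 : ℝ) ≤ k := by exact_mod_cast hk1
  have hk0 : (0 : ℝ) < k := by linarith
  have split : ∀ z : ℝ, 0 < z → z ^ σ = z * z ^ (σ - 1) := fun z hz => by
    rw [Real.rpow_sub hz, Real.rpow_one]
    field_simp
  -- Chosen so that k y is the lower bound (τ/2) k^σ log k for log M_k. Terms i ≤ k are then at most
  -- k y + A, and for i > k monotonicity in the index gives i y ≤ log M_i.
  set y : ℝ := τ / 2 * ((k : ℝ) ^ (σ - 1) * Real.log k) with hy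
  have hlog := Real.log_nonneg hk
  have hy0 : 0 ≤ y := by positivity
  have hky : k * y = τ / 2 * powLog σ k := by
    rw [powLog, split k hk0, hy]
    ring
  have hω : assocFun (pttSeq h τ σ) (Real.exp y) ≤ k * y + A := by
    refine assocFun_pttSeq_le hh (by linarith) (Real.exp_pos y) fun i => ?_
    rw [Real.log_exp]
    rcases le_or_gt i k with hik | hik
    · have h1 : (i : ℝ) * y ≤ k * y := by gcongr
      linarith [hA i]
    · have hik' : (k : ℝ) ≤ i := by exact_mod_cast hik.le
      have hi0 : (0 : ℝ) < i := by linarith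
      have h1 : (i : ℝ) * y ≤ τ / 2 * powLog σ i := by
        rw [powLog, split i hi0, hy]
        calc _ = τ / 2 * (i * (k : ℝ) ^ (σ - 1) * Real.log k) := by ring
          _ ≤ _ := by
            have : 0 ≤ σ - 1 := by linarith
            gcongr
      have h2 := (hN i (hkN.trans hik.le)).1
      have h3 : 0 ≤ k * y := by positivity
      linarith
  have h1 := le_youngConj_assocFun (x := x) hh hτ hσ hy0
  have h2 := mul_le_mul_of_nonneg_right hx hy0
  linarith

theorem exists_bmtWeight_bounds {h τ σ : ℝ} (hh : 0 < h) (hτ : 0 < τ) (hσ : 1 < σ) :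
    ∃ a b : ℝ, 0 < a ∧ 0 < b ∧ ∀ l : ℝ, 0 < l → ∀ᶠ j : ℕ in atTop,
      a * l ^ (σ - 1) * powLog σ j ≤ Real.log (bmtWeight (assocFun (pttSeq h τ σ)) l j) ∧
      Real.log (bmtWeight (assocFun (pttSeq h τ σ)) l j) ≤ b * l ^ (σ - 1) * powLog σ j := by
  obtain ⟨A, hA⟩ := exists_powLog_le_youngConj hh hτ hσ
  -- Upper constant: the index ⌈l j⌉ gives 4τ (2l)^σ / l. Lower constant: k = ⌊l j/2⌋ ≥ l j/4 gives
  -- (τ/4)(l/4)^σ / l, half of which is spent on the constant A.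
  refine ⟨τ / 8 * (1 / 4) ^ σ, 4 * τ * 2 ^ σ, by positivity, by positivity, fun l hl => ?_⟩
  have hpow : l ^ (σ - 1) = 1 / l * l ^ σ := by
    rw [Real.rpow_sub hl, Real.rpow_one]
    ring
  have hfloor : Tendsto (fun j : ℕ => ⌊l / 2 * (j : ℝ)⌋₊) atTop atTop :=
    tendsto_nat_floor_atTop.comp
      (tendsto_natCast_atTop_atTop.const_mul_atTop (by positivity))
  have hscale : Tendsto (fun j : ℕ => l / 4 * (j : ℝ)) atTop atTop :=
    tendsto_natCast_atTop_atTop.const_mul_atTop (by positivity)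
  filter_upwards [eventually_log_pttSeq_natCeil_le (σ := σ) (c := l) hh hτ (by linarith) hl,
    hfloor.eventually hA, hscale.eventually_ge_atTop 1,
    tendsto_natCast_atTop_atTop.eventually (eventually_powLog_mul_bounds σ (c := l / 4)
      (by positivity)),
    tendsto_natCast_atTop_atTop.eventually (eventually_const_le_powLog hσ.le A
      (ε := τ / 8 * (l / 4) ^ σ) (by positivity))] with j h1 h2 h3 h4 h5
  rw [bmtWeight, Real.log_exp, hpow]
  have hl' : 0 < 1 / l := by positivity
  constructor
  · have h6 : l / 4 * j ≤ (⌊l / 2 * (j : ℝ)⌋₊ : ℕ) := by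
      linarith [Nat.sub_one_lt_floor (l / 2 * (j : ℝ))]
    have h7 := h2 (l * j) (by
      linarith [Nat.floor_le (a := l / 2 * (j : ℝ)) (by positivity)])
    have h8 := powLog_le_powLog (σ := σ) (by linarith) h3 h6
    have h9 := mul_le_mul_of_nonneg_left (h4.1.trans h8) (half_pos hτ).le
    have h10 : (l / 4) ^ σ = l ^ σ * (1 / 4) ^ σ := by
      rw [← Real.mul_rpow hl.le (by norm_num)]
      congr 1
      ring
    rw [h10] at h9 h5
    calc _ = 1 / l * (τ / 8 * (l ^ σ * (1 / 4) ^ σ) * powLog σ j) := by ring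
      _ ≤ _ := by
        gcongr
        linarith
  · have h6 := (youngConj_assocFun_le hh hτ hσ (l * j)).trans h1
    rw [Real.mul_rpow (by norm_num) hl.le] at h6
    calc _ ≤ 1 / l * (4 * τ * (2 ^ σ * l ^ σ) * powLog σ j) := by gcongr
      _ = _ := by ring

/-- The factor l^j costs at most (τ/4) j^σ log j, so l disappears from the bounds. -/
theorem eventually_geomWeight_bounds {τ σ l : ℝ} (hτ : 0 < τ) (hl : 0 < l) (hσ : 1 < σ) :
    ∀ᶠ j : ℕ in atTop, τ / 4 * powLog σ j ≤ Real.log (geomWeight (pttSeq τ τ σ) l j) ∧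
      Real.log (geomWeight (pttSeq τ τ σ) l j) ≤ 3 * τ * powLog σ j := by
  filter_upwards [eventually_log_pttSeq_bounds (σ := σ) hτ hτ (by linarith),
    tendsto_natCast_atTop_atTop.eventually
      (eventually_mul_le_powLog hσ.le |Real.log l| (ε := τ / 4) (by positivity)),
    eventually_ge_atTop 1] with j h1 h2 h3
  have h4 : 0 ≤ powLog σ j := powLog_nonneg (by exact_mod_cast h3)
  have h5 : |j * Real.log l| ≤ τ / 4 * powLog σ j := by
    rwa [abs_mul, Nat.abs_cast, mul_comm]
  have h6 := abs_le.1 h5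
  have h7 : 0 ≤ τ * powLog σ j := by positivity
  rw [geomWeight, Real.log_mul (by positivity) (pttSeq_pos hτ (by linarith) j).ne', Real.log_pow]
  constructor <;> linarith

/-- `w'` dominates `w` up to a constant factor. -/
def WeightLE (w w' : ℕ → ℝ) : Prop := ∃ C : ℝ, 0 ≤ C ∧ ∀ j, w j ≤ C * w' j

theorem weightLE_of_eventually_log_le {w w' : ℕ → ℝ} (hw : ∀ j, 0 < w j) (hw' : ∀ j, 0 < w' j)
    (H : ∀ᶠ j in atTop, Real.log (w j) ≤ Real.log (w' j)) : WeightLE w w' := by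
  obtain ⟨C, hC, h⟩ := exists_forall_le_of_eventually_le (f := fun j => w j / w' j) (B := 1)
    (H.mono fun j hj => (div_le_one (hw' j)).2 ((Real.log_le_log_iff (hw j) (hw' j)).1 hj))
  exact ⟨C, hC, fun j => (div_le_iff₀ (hw' j)).1 (h j)⟩

theorem bmtWeight_pos (ω : ℝ → ℝ) (l : ℝ) (j : ℕ) : 0 < bmtWeight ω l j := Real.exp_pos _

theorem geomWeight_pos {M : ℕ → ℝ} (hM : ∀ j, 0 < M j) {l : ℝ} (hl : 0 < l) (j : ℕ) :
    0 < geomWeight M l j := mul_pos (pow_pos hl j) (hM j)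

theorem weightLE_of_powLog_bounds {w w' : ℕ → ℝ} (hw : ∀ j, 0 < w j) (hw' : ∀ j, 0 < w' j)
    {σ a b : ℝ} (hab : a ≤ b) (h : ∀ᶠ j : ℕ in atTop, Real.log (w j) ≤ a * powLog σ j)
    (h' : ∀ᶠ j : ℕ in atTop, b * powLog σ j ≤ Real.log (w' j)) : WeightLE w w' := by
  refine weightLE_of_eventually_log_le hw hw' ?_
  filter_upwards [h, h', eventually_ge_atTop 1] with j h1 h2 h3
  exact h1.trans (le_trans (mul_le_mul_of_nonneg_right hab
    (powLog_nonneg (by exact_mod_cast h3))) h2)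

theorem exists_rpow_eq {σ c : ℝ} (hσ : 1 < σ) (hc : 0 < c) :
    ∃ l : ℝ, 0 < l ∧ l ^ (σ - 1) = c :=
  ⟨c ^ (σ - 1)⁻¹, by positivity, Real.rpow_inv_rpow hc.le (by linarith)⟩

/-- The two families of weights are cofinal to each other in both directions. -/
theorem geomWeight_bmtWeight_cofinal {h τ σ : ℝ} (hh : 0 < h) (hτ : 0 < τ) (hσ : 1 < σ) :
    (∀ x l : ℝ, 0 < x → 0 < l → ∃ m : ℝ, 0 < m ∧
      WeightLE (geomWeight (pttSeq x x σ) l) (bmtWeight (assocFun (pttSeq h τ σ)) m)) ∧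
    (∀ x l : ℝ, 0 < x → 0 < l → ∃ m : ℝ, 0 < m ∧
      WeightLE (bmtWeight (assocFun (pttSeq h τ σ)) m) (geomWeight (pttSeq x x σ) l)) ∧
    (∀ m : ℝ, 0 < m → ∃ x : ℝ, 0 < x ∧
      WeightLE (geomWeight (pttSeq x x σ) 1) (bmtWeight (assocFun (pttSeq h τ σ)) m)) ∧
    (∀ m : ℝ, 0 < m → ∃ x : ℝ, 0 < x ∧
      WeightLE (bmtWeight (assocFun (pttSeq h τ σ)) m) (geomWeight (pttSeq x x σ) 1)) := by
  obtain ⟨a, b, ha, hb, H⟩ := exists_bmtWeight_bounds hh hτ hσ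
  have hg : ∀ x l : ℝ, 0 < x → 0 < l → ∀ j, 0 < geomWeight (pttSeq x x σ) l j :=
    fun x l hx hl => geomWeight_pos (pttSeq_pos hx (by linarith)) hl
  refine ⟨fun x l hx hl => ?_, fun x l hx hl => ?_, fun m hm => ?_, fun m hm => ?_⟩
  -- m solves a m^(σ-1) = 3x, matching the upper constant of one weight to the lower constant of the
  -- other.
  · obtain ⟨m, hm, hm'⟩ := exists_rpow_eq (c := 3 * x / a) hσ (by positivity)
    exact ⟨m, hm, weightLE_of_powLog_bounds (hg x l hx hl) (bmtWeight_pos _ _)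
      (by rw [hm', mul_div_cancel₀ _ ha.ne'])
      ((eventually_geomWeight_bounds hx hl hσ).mono fun _ h => h.2)
      ((H m hm).mono fun _ h => h.1)⟩
  · obtain ⟨m, hm, hm'⟩ := exists_rpow_eq (c := x / 4 / b) hσ (by positivity)
    exact ⟨m, hm, weightLE_of_powLog_bounds (bmtWeight_pos _ _) (hg x l hx hl)
      (by rw [hm', mul_div_cancel₀ _ hb.ne'])
      ((H m hm).mono fun _ h => h.2)
      ((eventually_geomWeight_bounds hx hl hσ).mono fun _ h => h.1)⟩
  -- Now m is given and the matrix index x is solved for; the geometric parameter can stay equal to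
  -- 1.
  · have hx : 0 < a * m ^ (σ - 1) / 3 := by positivity
    exact ⟨_, hx, weightLE_of_powLog_bounds (hg _ 1 hx one_pos) (bmtWeight_pos _ _)
      (by rw [mul_div_cancel₀ _ (by norm_num)])
      ((eventually_geomWeight_bounds hx one_pos hσ).mono fun _ h => h.2)
      ((H m hm).mono fun _ h => h.1)⟩
  · have hx : 0 < 4 * (b * m ^ (σ - 1)) := by positivity
    exact ⟨_, hx, weightLE_of_powLog_bounds (bmtWeight_pos _ _) (hg _ 1 hx one_pos)
      (by rw [mul_div_cancel_left₀ _ (by norm_num)])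
      ((H m hm).mono fun _ h => h.2)
      ((eventually_geomWeight_bounds hx one_pos hσ).mono fun _ h => h.1)⟩

/-! ### Continuous inclusions of spaces of functions -/

/-- Continuous inclusion of spaces of functions. -/
def FunSpace.Emb {X : Type*} (F G : FunSpace 𝕜 X) : Prop :=
  ∃ h : F.carrier ≤ G.carrier, @Continuous _ _ F.top G.top (Submodule.inclusion h)

/-- The topology is a locally convex vector space topology. -/
def FunSpace.IsLC {X : Type*} (F : FunSpace 𝕜 X) : Prop :=
  @IsTopologicalAddGroup _ F.top _ ∧ @ContinuousSMul 𝕜 _ _ _ F.top ∧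
    @LocallyConvexSpace ℝ _ _ _ _ _ F.top

namespace FunSpace

variable {X ι κ : Type*}

theorem Emb.trans {F G H : FunSpace 𝕜 X} (h₁ : F.Emb G) (h₂ : G.Emb H) : F.Emb H := by
  obtain ⟨h₁, c₁⟩ := h₁
  obtain ⟨h₂, c₂⟩ := h₂
  exact ⟨h₁.trans h₂, @Continuous.comp _ _ _ F.top G.top H.top _ _ c₂ c₁⟩

theorem Emb.antisymm {F G : FunSpace 𝕜 X} (h₁ : F.Emb G) (h₂ : G.Emb F) : F = G := by
  obtain ⟨F, TF⟩ := F
  obtain ⟨G, TG⟩ := G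
  obtain ⟨h₁, c₁⟩ := h₁
  obtain ⟨h₂, c₂⟩ := h₂
  obtain rfl : F = G := le_antisymm h₁ h₂
  congr 1
  exact le_antisymm (continuous_id_iff_le.1 c₁) (continuous_id_iff_le.1 c₂)

/-- Supplies the hypothesis on the target in `indLim_emb` when that target is itself an inductive
limit. -/
theorem isLC_indLim (F : ι → FunSpace 𝕜 X) : (indLim F).IsLC :=
  ⟨topologicalAddGroup_sInf fun _ hT => hT.1, continuousSMul_sInf fun _ hT => hT.2.1,
    LocallyConvexSpace.sInf fun _ hT => hT.2.2.1⟩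

theorem emb_indLim (F : ι → FunSpace 𝕜 X) (i : ι) : (F i).Emb (indLim F) :=
  ⟨le_iSup (fun i => (F i).carrier) i, continuous_sInf_rng.2 fun _ hT => hT.2.2.2 i⟩

/-- The topology induced from G is one of the competitors in the infimum defining the inductive
limit topology. -/
theorem indLim_emb {F : ι → FunSpace 𝕜 X} {G : FunSpace 𝕜 X} (hG : G.IsLC)
    (h : ∀ i, (F i).Emb G) : (indLim F).Emb G := by
  have hle : (⨆ i, (F i).carrier) ≤ G.carrier := iSup_le fun i => (h i).1
  obtain ⟨h₁, h₂, h₃⟩ := hG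
  let _ := G.top
  refine ⟨hle, continuous_iff_le_induced.2 (sInf_le ⟨?_, ?_, ?_, fun i => ?_⟩)⟩
  · exact topologicalAddGroup_induced (Submodule.inclusion hle)
  · exact continuousSMul_induced (Submodule.inclusion hle)
  · exact LocallyConvexSpace.induced ((Submodule.inclusion hle).restrictScalars ℝ)
  · exact continuous_induced_rng.2 (h i).2

theorem projLim_emb (F : ι → FunSpace 𝕜 X) (i : ι) : (projLim F).Emb (F i) :=
  ⟨iInf_le (fun i => (F i).carrier) i, continuous_iff_le_induced.2 (iInf_le _ i)⟩

theorem emb_projLim {F : ι → FunSpace 𝕜 X} {G : FunSpace 𝕜 X} (h : ∀ i, G.Emb (F i)) :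
    G.Emb (projLim F) :=
  ⟨le_iInf fun i => (h i).1,
    continuous_iInf_rng.2 fun i => continuous_induced_rng.2 (h i).2⟩

theorem projLimCompact_emb {U : Set (Rn d)} {F G : ∀ K : RegCompact U, FunSpace 𝕜 (interior K.1)}
    (h : ∀ K, (F K).Emb (G K)) : (projLimCompact F).Emb (projLimCompact G) := by
  refine ⟨inf_le_inf_left _ (iInf_mono fun K => Submodule.comap_mono (h K).1),
    continuous_iInf_rng.2 fun K => continuous_induced_rng.2 ?_⟩
  exact @Continuous.comp _ _ _ (projLimCompact F).top (F K).top (G K).top _ _ (h K).2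
    (continuous_iff_le_induced.2 (iInf_le _ K))

end FunSpace

theorem div_abs_le_mul_div_abs {x v w C : ℝ} (hx : 0 ≤ x) (hv : 0 < v) (hw : 0 < w)
    (h : v ≤ C * w) : x / |w| ≤ C * (x / |v|) := by
  rw [abs_of_pos hv, abs_of_pos hw, ← mul_div_assoc, div_le_div_iff₀ hw hv]
  nlinarith [mul_le_mul_of_nonneg_left h hx]

theorem stepSpace_emb {w w' : ℕ → ℝ} (hw : ∀ j, 0 < w j) (hw' : ∀ j, 0 < w' j)
    (h : WeightLE w w') (K : Set (Rn d)) : (stepSpace 𝕜 w K).Emb (stepSpace 𝕜 w' K) := by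
  obtain ⟨C, hC, h⟩ := h
  have hle : boundedFun 𝕜 w K ≤ boundedFun 𝕜 w' K := by
    rintro f ⟨hf, A, hA⟩
    refine ⟨hf, C * A, ?_⟩
    rintro _ ⟨p, rfl⟩
    exact (div_abs_le_mul_div_abs (norm_nonneg _) (hw _) (hw' _) (h _)).trans
      (mul_le_mul_of_nonneg_left (hA (mem_range_self p)) hC)
  refine ⟨hle, ?_⟩
  let _ := (supNorm 𝕜 w K).toAddGroupSeminorm.toSeminormedAddCommGroup
  let _ := (supNorm 𝕜 w' K).toAddGroupSeminorm.toSeminormedAddCommGroup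
  refine AddMonoidHomClass.continuous_of_bound (Submodule.inclusion hle) C fun f => ?_
  change supNorm 𝕜 w' K (Submodule.inclusion hle f) ≤ C * supNorm 𝕜 w K f
  refine Real.iSup_le (fun p => ?_) (mul_nonneg hC (apply_nonneg _ f))
  exact (div_abs_le_mul_div_abs (norm_nonneg _) (hw _) (hw' _) (h _)).trans
    (mul_le_mul_of_nonneg_left (le_ciSup f.2.2 p) hC)

/-! ### Equality of the classes -/

open FunSpace in
theorem matrixRoumieu_eq_bmtRoumieu {h τ σ : ℝ} (hh : 0 < h) (hτ : 0 < τ) (hσ : 1 < σ)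
    (U : Set (Rn d)) :
    matrixRoumieu 𝕜 (pttMatrix σ) U = bmtRoumieu 𝕜 (assocFun (pttSeq h τ σ)) U := by
  -- Inductive limits need every weight of the source family to be dominated by some weight of the
  -- target family.
  obtain ⟨h₁, -, -, h₂⟩ := geomWeight_bmtWeight_cofinal hh hτ hσ
  have hg : ∀ x l : ℝ, 0 < x → 0 < l → ∀ j, 0 < geomWeight (pttSeq x x σ) l j :=
    fun x l hx hl => geomWeight_pos (pttSeq_pos hx (by linarith)) hl
  refine Emb.antisymm (projLimCompact_emb fun K => ?_) (projLimCompact_emb fun K => ?_)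
  · refine indLim_emb (isLC_indLim _) fun x => indLim_emb (isLC_indLim _) fun l => ?_
    obtain ⟨m, hm, H⟩ := h₁ x l x.2 l.2
    exact (stepSpace_emb (hg x l x.2 l.2) (bmtWeight_pos _ _) H K.1).trans
      (emb_indLim (fun m : Ioi (0 : ℝ) => stepSpace 𝕜 (bmtWeight _ m) K.1) ⟨m, hm⟩)
  · refine indLim_emb (isLC_indLim _) fun m => ?_
    obtain ⟨x, hx, H⟩ := h₂ m m.2
    exact (stepSpace_emb (bmtWeight_pos _ _) (hg x 1 hx one_pos) H K.1).trans
      ((emb_indLim (fun l : Ioi (0 : ℝ) => stepSpace 𝕜 (geomWeight (pttMatrix σ ⟨x, hx⟩) l) K.1)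
        ⟨1, mem_Ioi.2 one_pos⟩).trans
      (emb_indLim (fun x : Ioi (0 : ℝ) => indLim fun l : Ioi (0 : ℝ) =>
        stepSpace 𝕜 (geomWeight (pttMatrix σ x) l) K.1) ⟨x, hx⟩))

open FunSpace in
theorem matrixBeurling_eq_bmtBeurling {h τ σ : ℝ} (hh : 0 < h) (hτ : 0 < τ) (hσ : 1 < σ)
    (U : Set (Rn d)) :
    matrixBeurling 𝕜 (pttMatrix σ) U = bmtBeurling 𝕜 (assocFun (pttSeq h τ σ)) U := by
  -- For projective limits the quantifiers are reversed: every weight of the target family must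
  -- dominate some weight of the source family.
  obtain ⟨-, h₁, h₂, -⟩ := geomWeight_bmtWeight_cofinal hh hτ hσ
  have hg : ∀ x l : ℝ, 0 < x → 0 < l → ∀ j, 0 < geomWeight (pttSeq x x σ) l j :=
    fun x l hx hl => geomWeight_pos (pttSeq_pos hx (by linarith)) hl
  refine Emb.antisymm (projLimCompact_emb fun K => ?_) (projLimCompact_emb fun K => ?_)
  · refine emb_projLim fun m => ?_
    obtain ⟨x, hx, H⟩ := h₂ m m.2
    exact ((projLim_emb (fun x : Ioi (0 : ℝ) => projLim fun l : Ioi (0 : ℝ) =>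
        stepSpace 𝕜 (geomWeight (pttMatrix σ x) l) K.1) ⟨x, hx⟩).trans
      (projLim_emb (fun l : Ioi (0 : ℝ) => stepSpace 𝕜 (geomWeight (pttMatrix σ ⟨x, hx⟩) l) K.1)
        ⟨1, mem_Ioi.2 one_pos⟩)).trans
      (stepSpace_emb (hg x 1 hx one_pos) (bmtWeight_pos _ _) H K.1)
  · refine emb_projLim fun x => emb_projLim fun l => ?_
    obtain ⟨m, hm, H⟩ := h₁ x l x.2 l.2
    exact (projLim_emb (fun m : Ioi (0 : ℝ) => stepSpace 𝕜 (bmtWeight _ m) K.1) ⟨m, hm⟩).trans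
      (stepSpace_emb (bmtWeight_pos _ _) (hg x l x.2 l.2) H K.1)

end

theorem mainTheorem1 (𝕜 : Type*) [RCLike 𝕜] (σ : ℝ) (hσ : 1 < σ) :
    -- the associated functions are finite and are weight functions
    (∀ h τ : ℝ, 0 < h → 0 < τ →
      (∀ t : ℝ, 0 < t → BddAbove (Set.range fun j : ℕ => Real.log (t ^ j / pttSeq h τ σ j))) ∧
      IsWeightFunction (assocFun (pttSeq h τ σ))) ∧
    -- the classes of the matrix are the classes of `ω^{(σ)}`
    (∀ (d : ℕ) (U : Set (Rn d)), IsOpen U → U.Nonempty →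
      matrixRoumieu 𝕜 (pttMatrix σ) U = bmtRoumieu 𝕜 (assocFun (pttSeq 1 1 σ)) U ∧
      matrixBeurling 𝕜 (pttMatrix σ) U = bmtBeurling 𝕜 (assocFun (pttSeq 1 1 σ)) U) ∧
    -- all associated functions are equivalent
    (∀ h h' τ τ' : ℝ, 0 < h → 0 < h' → 0 < τ → 0 < τ' →
      WeightEquiv (assocFun (pttSeq h τ σ)) (assocFun (pttSeq h' τ' σ))) ∧
    -- any of them can be used in place of `ω^{(σ)}`
    (∀ h τ : ℝ, 0 < h → 0 < τ → ∀ (d : ℕ) (U : Set (Rn d)), IsOpen U → U.Nonempty →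
      matrixRoumieu 𝕜 (pttMatrix σ) U = bmtRoumieu 𝕜 (assocFun (pttSeq h τ σ)) U ∧
      matrixBeurling 𝕜 (pttMatrix σ) U = bmtBeurling 𝕜 (assocFun (pttSeq h τ σ)) U) := by
  refine ⟨fun h τ hh hτ => ⟨fun t ht => bddAbove_log_pow_div_pttSeq hh hτ hσ ht,
      isWeightFunction_assocFun_pttSeq hh hτ hσ⟩,
    fun d U _ _ => ⟨matrixRoumieu_eq_bmtRoumieu one_pos one_pos hσ U,
      matrixBeurling_eq_bmtBeurling one_pos one_pos hσ U⟩,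
    fun h h' τ τ' hh hh' hτ hτ' => weightEquiv_assocFun_pttSeq hh hτ hh' hτ' hσ,
    fun h τ hh hτ d U _ _ => ⟨matrixRoumieu_eq_bmtRoumieu hh hτ hσ U,
      matrixBeurling_eq_bmtBeurling hh hτ hσ U⟩⟩
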